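/- Let $\eta,\delta,\rho,T>0$, $\theta\in(0,1]$, $d\ge 0$, $x_a<x_b$, and let $p_0:[x_a,x_b]\to(0,\infty)$ be continuously differentiable. Write $\kappa=2(\delta-\eta)+\rho$, $\xi=\sqrt{\kappa^2+4\eta^2}$ and $$\tau^*_t=\frac{\eta\left((1-\theta)\xi-\{(1-\theta)\kappa-2\theta\}\tanh\left[\tfrac12\xi(T-t)\right]\right)}{\theta\xi+\{\theta\kappa+2\eta^2(1-\theta)\}\tanh\left[\tfrac12\xi(T-t)\right]}.$$ For $P>0$, the local (non-spatial) control problem with initial stock $P$ is to minimize, over continuous tax rates $\tau$ on $[0,T]$, $$\int_0^T\frac{p_t^2(1+\tau_t^2)}{2}e^{-\rho t}\,dt+\frac{1-\theta}{\theta}\,\frac{p_T^2}{2}e^{-\rho T},\qquad \dot p_t=[\eta(1-\tau_t)-\delta]p_t,\quad p_0=P.$$ A pair $(\bar p,\bar u)$ of functions of $(x,t)\in[x_a,x_b]\times[0,T]$ is called locally optimal, with taxes $\tau_{x,t}$, if for every $x$ the tax $\tau_{x,\cdot}$ is optimal in the local control problem with initial stock $p_0(x)$, $\bar u_{x,t}=\tau_{x,t}\bar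 p_{x,t}$, and $\bar p$ is a classical solution of $$\frac{\partial\bar p}{\partial t}=d\,\frac{\partial^2\bar p}{\partial x^2}+(\eta-\delta)\bar p-\eta\bar u\ \text{ on }(x_a,x_b)\times(0,T),\qquad \frac{\partial\bar p}{\partial x}=\frac{\partial\bar u}{\partial x}=0\ \text{ for }x\in\{x_a,x_b\},\ 0<t\le T,\qquad \bar p_{x,0}=p_0(x).$$ Here "classical solution" means that $\bar p$ is continuous on $[x_a,x_b]\times[0,T]$, that $\partial\bar p/\partial x$ exists and is continuous on $[x_a,x_b]\times(0,T]$, and that $\partial^2\bar p/\partial x^2$ exists and is continuous on $(x_a,x_b)\times(0,T)$, where $\partial\bar p/\partial t$ exists and the equation holds. Then every locally optimal pair has the taxes $\tau_{x,t}=\tau^*_t$ and is given on $[x_a,x_b]\times[0,T]$ by $$\bar p_{x,t}=e^{\int_0^t(\eta-\delta-\eta\tau^*_s)\,ds}\left[\frac{A_0}{2}+\sum_{n\ge1}A_n\,e^{-d\left(\frac{n\pi}{x_b-x_a}\right)^2t}\cos\left(n\pi\,\frac{x-x_a}{x_b-x_a}\right)\right],\qquad \bar u_{x,t}=\tau^*_t\,\bar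 p_{x,t},$$ where the series converges and $$A_n=\frac{2}{x_b-x_a}\int_{x_a}^{x_b}p_0(x)\cos\left(n\pi\,\frac{x-x_a}{x_b-x_a}\right)dx\qquad(n\ge0).$$ Conversely, the pair given by these formulas is locally optimal with taxes $\tau^*_t$ if $d>0$, and also if $d=0$ provided that $p_0$ is twice continuously differentiable on $[x_a,x_b]$ with $p_0'(x_a)=p_0'(x_b)=0$. If moreover $p_0(x_a+x_b-x)=p_0(x)$ for all $x\in[x_a,x_b]$, then only even frequencies occur: $$\bar p_{x,t}=e^{\int_0^t(\eta-\delta-\eta\tau^*_s)\,ds}\left[\frac{A_0}{2}+\sum_{n\ge1}A_{2n}\,e^{-d\left(\frac{2n\pi}{x_b-x_a}\right)^2t}\cos\left(2n\pi\,\frac{x-x_a}{x_b-x_a}\right)\right].$$ -/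

import Mathlib

open Set Real

noncomputable section

/-- `p` is the pollution stock generated on `[0, T]` by the tax rate `τ` in an economy without
spatial interaction: `p' = [η (1 - τ) - δ] p`, `p 0 = P`. -/
structure IsStockPath (η δ T P : ℝ) (τ p : ℝ → ℝ) : Prop where
  init : p 0 = P
  ode : ∀ t ∈ Icc 0 T, HasDerivWithinAt p ((η * (1 - τ t) - δ) * p t) (Icc 0 T) t

/-- The social cost of a tax rate `τ` with pollution path `p` (no spatial dimension). -/
def socialCost (ρ θ T : ℝ) (τ p : ℝ → ℝ) : ℝ :=
  (∫ t in (0 : ℝ)..T, p t ^ 2 * (1 + τ t ^ 2) / 2 * exp (-ρ * t))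
    + (1 - θ) / θ * (p T ^ 2 / 2) * exp (-ρ * T)

/-- `τ` is an optimal tax rate for a policymaker who starts from the pollution stock `P` and
ignores diffusion: it minimizes the social cost among all continuous tax rates. -/
structure IsOptimalTax (η δ ρ θ T P : ℝ) (τ : ℝ → ℝ) : Prop where
  cont : ContinuousOn τ (Icc 0 T)
  minimal : ∃ p, IsStockPath η δ T P τ p ∧
    ∀ σ q, ContinuousOn σ (Icc 0 T) → IsStockPath η δ T P σ q →
      socialCost ρ θ T τ p ≤ socialCost ρ θ T σ q

/-- `p` is a classical solution of
`∂p/∂t = d ∂²p/∂x² + (η - δ) p - η u` on `(xa, xb) × (0, T)`, with `p(x, 0) = p0 x`, and the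
Neumann conditions `∂p/∂x = ∂u/∂x = 0` hold at both end points. The functions `px`, `pxx` are the
space derivatives of `p`. -/
structure IsPollutionSolution (η δ T d xa xb : ℝ) (p0 : ℝ → ℝ) (p u : ℝ → ℝ → ℝ) : Prop where
  cont : ContinuousOn (fun z : ℝ × ℝ => p z.1 z.2) (Icc xa xb ×ˢ Icc 0 T)
  init : ∀ x ∈ Icc xa xb, p x 0 = p0 x
  pde : ∃ px pxx : ℝ → ℝ → ℝ,
    (∀ x ∈ Icc xa xb, ∀ t ∈ Ioc 0 T,
      HasDerivWithinAt (fun y => p y t) (px x t) (Icc xa xb) x) ∧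
    ContinuousOn (fun z : ℝ × ℝ => px z.1 z.2) (Icc xa xb ×ˢ Ioc 0 T) ∧
    (∀ x ∈ Ioo xa xb, ∀ t ∈ Ioo 0 T, HasDerivAt (fun y => px y t) (pxx x t) x) ∧
    ContinuousOn (fun z : ℝ × ℝ => pxx z.1 z.2) (Ioo xa xb ×ˢ Ioo 0 T) ∧
    (∀ x ∈ Ioo xa xb, ∀ t ∈ Ioo 0 T,
      HasDerivAt (fun s => p x s) (d * pxx x t + (η - δ) * p x t - η * u x t) t)
  neumann_p : ∀ x ∈ ({xa, xb} : Set ℝ), ∀ t ∈ Ioc 0 T,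
    HasDerivWithinAt (fun y => p y t) 0 (Icc xa xb) x
  neumann_u : ∀ x ∈ ({xa, xb} : Set ℝ), ∀ t ∈ Ioc 0 T,
    HasDerivWithinAt (fun y => u y t) 0 (Icc xa xb) x

/-- `(p, u)` is a locally optimal pair, with local taxes `τ x t`: at each location `x` the local
policymaker chooses a tax that is optimal for the problem without diffusion started from the local
stock `p0 x`, the control is `u = τ p`, and `p` evolves by the diffusion equation. -/
structure IsLocallyOptimal (η δ ρ θ T d xa xb : ℝ) (p0 : ℝ → ℝ) (τ p u : ℝ → ℝ → ℝ) : Prop where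
  tax : ∀ x ∈ Icc xa xb, IsOptimalTax η δ ρ θ T (p0 x) (τ x)
  control : ∀ x ∈ Icc xa xb, ∀ t ∈ Icc 0 T, u x t = τ x t * p x t
  pollution : IsPollutionSolution η δ T d xa xb p0 p u

/-- `κ = 2 (δ - η) + ρ`. -/
def kap (η δ ρ : ℝ) : ℝ := 2 * (δ - η) + ρ

/-- `ξ = √(κ² + 4 η²)`. -/
def xi (η δ ρ : ℝ) : ℝ := √(kap η δ ρ ^ 2 + 4 * η ^ 2)

/-- The closed form of the local environmental tax. -/
def localTax (η δ ρ θ T t : ℝ) : ℝ :=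
  η * ((1 - θ) * xi η δ ρ
      - ((1 - θ) * kap η δ ρ - 2 * θ) * tanh (xi η δ ρ * (T - t) / 2))
    / (θ * xi η δ ρ
      + (θ * kap η δ ρ + 2 * η ^ 2 * (1 - θ)) * tanh (xi η δ ρ * (T - t) / 2))

/-- The cosine `cos (k π (x - xa) / (xb - xa))`. -/
def cosMode (xa xb : ℝ) (k : ℕ) (x : ℝ) : ℝ := cos (k * π * ((x - xa) / (xb - xa)))

/-- The Fourier cosine coefficient of `p0` on `[xa, xb]` for the frequency `k π / (xb - xa)`. -/
def cosCoeff (xa xb : ℝ) (p0 : ℝ → ℝ) (k : ℕ) : ℝ :=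
  2 / (xb - xa) * ∫ x in xa..xb, p0 x * cosMode xa xb k x

/-- The term of frequency `k π / (xb - xa)` in the cosine series, with its diffusive decay. -/
def heatTerm (d xa xb : ℝ) (p0 : ℝ → ℝ) (x t : ℝ) (k : ℕ) : ℝ :=
  cosCoeff xa xb p0 k * exp (-d * (k * π / (xb - xa)) ^ 2 * t) * cosMode xa xb k x

/-- The growth factor `exp (∫₀ᵗ (η - δ - η τ*ₛ) ds)`. -/
def growthFactor (η δ ρ θ T t : ℝ) : ℝ :=
  exp (∫ s in (0 : ℝ)..t, (η - δ - η * localTax η δ ρ θ T s))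

/-- The closed form of the pollution in the local solution. -/
def localPollution (η δ ρ θ T d xa xb : ℝ) (p0 : ℝ → ℝ) (x t : ℝ) : ℝ :=
  growthFactor η δ ρ θ T t *
    (cosCoeff xa xb p0 0 / 2 + ∑' n : ℕ, heatTerm d xa xb p0 x t (n + 1))

end

/-! The control problem and the diffusion problem decouple. Each local problem is linear-quadratic:
`localTax` solves a Riccati equation whose terminal value matches the scrap cost, so `τ*_t p²
e^{-ρt} / (2η)` is a value function. Differentiating it along an arbitrary stock path completes the
square (`socialCost_eq`): the cost is a constant plus the integral of `q² (σ - τ*)² e^{-ρt} / 2`.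
Hence `τ*` is optimal. It is the only optimum because a stock that starts nonzero is an exponential
and never vanishes. The optimum does not depend on the initial stock, so the tax is the same at
every location.

With `u = τ*_t p`, dividing the pollution by `growthFactor` removes the zeroth-order term and leaves
the Neumann heat equation. For uniqueness, `IsHeatSolution.nonpos` is a maximum principle with a
barrier; for `d = 0` the quotient is simply constant in time. For existence, the even reflection of
a `C¹` function has absolutely summable Fourier coefficients (`cosSeries`). This dominates the
series down to `t = 0`, and for `d > 0` the exponential decay pays for two space derivatives at
positive times. Symmetry of the data kills the odd coefficients. -/

/-! ### Linear differential equations on a compact interval. -/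

/-- On a compact interval, the integral of a continuous function is a primitive of it. -/
theorem hasDerivWithinAt_integral_Icc {f : ℝ → ℝ} {a b : ℝ} (hf : ContinuousOn f (Icc a b)) {t : ℝ}
    (ht : t ∈ Icc a b) : HasDerivWithinAt (fun t => ∫ s in a..t, f s) (f t) (Icc a b) t := by
  have hab : a ≤ b := ht.1.trans ht.2
  -- A globally continuous extension has a two-sided derivative of its integral, even at the end
  -- points.
  have hg : Continuous (IccExtend hab (fun x : Icc a b => f x)) :=
    Continuous.Icc_extend' (continuousOn_iff_continuous_domRestrict.mp hf)
  have h1 := (intervalIntegral.integral_hasDerivAt_right (hg.intervalIntegrable a t)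
    hg.aestronglyMeasurable.stronglyMeasurableAtFilter hg.continuousAt).hasDerivWithinAt
      (s := Icc a b)
  rw [IccExtend_of_mem hab _ ht] at h1
  have key : ∀ u ∈ Icc a b, ∫ s in a..u, f s = ∫ s in a..u,
      IccExtend hab (fun x : Icc a b => f x) s := by
    intro u hu
    refine intervalIntegral.integral_congr fun s hs => ?_
    rw [uIcc_of_le hu.1] at hs
    exact (IccExtend_of_mem hab (fun x : Icc a b => f x) ⟨hs.1, hs.2.trans hu.2⟩).symm
  exact h1.congr (fun u hu => key u hu) (key t ht)

/-- A solution of the linear equation `q' = a q` is an exponential. -/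
theorem eq_exp_integral_of_hasDerivWithinAt {a q : ℝ → ℝ} {T : ℝ} (hT : 0 < T)
    (ha : ContinuousOn a (Icc 0 T))
    (hq : ∀ t ∈ Icc 0 T, HasDerivWithinAt q (a t * q t) (Icc 0 T) t) {t : ℝ}
    (ht : t ∈ Icc 0 T) : q t = q 0 * exp (∫ s in (0 : ℝ)..t, a s) := by
  have hd : ∀ s ∈ Icc 0 T,
      HasDerivWithinAt (fun s => q s * exp (-∫ r in (0 : ℝ)..s, a r)) 0 (Icc 0 T) s := by
    intro s hs
    have := (hq s hs).mul (hasDerivWithinAt_integral_Icc ha hs).neg.exp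
    convert! this using 1
    ring
  have h := (convex_Icc 0 T).is_const_of_fderivWithin_eq_zero (𝕜 := ℝ)
    (fun s hs => (hd s hs).differentiableWithinAt)
    (fun s hs => by
      have := (hd s hs).hasFDerivWithinAt.fderivWithin (uniqueDiffOn_Icc hT s hs)
      simpa using this) ht (left_mem_Icc.mpr (ht.1.trans ht.2))
  simp only [intervalIntegral.integral_same, neg_zero, exp_zero, mul_one] at h
  rw [← h, mul_assoc, ← exp_add]
  simp

/-! ### The closed-form tax and its Riccati equation. -/

theorem abs_kap_lt_xi (η δ ρ : ℝ) (hη : 0 < η) : |kap η δ ρ| < xi η δ ρ := by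
  rw [xi, ← sqrt_sq_eq_abs]
  exact sqrt_lt_sqrt (sq_nonneg _) (by nlinarith [pow_pos hη 2])

theorem xi_sq (η δ ρ : ℝ) : xi η δ ρ ^ 2 = kap η δ ρ ^ 2 + 4 * η ^ 2 :=
  sq_sqrt (by positivity)

theorem xi_pos (δ ρ : ℝ) {η : ℝ} (hη : 0 < η) : 0 < xi η δ ρ :=
  sqrt_pos.mpr (by nlinarith [pow_pos hη 2, sq_nonneg (kap η δ ρ)])

theorem tanh_nonneg {x : ℝ} (hx : 0 ≤ x) : 0 ≤ tanh x := by
  rw [tanh_eq_sinh_div_cosh]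
  exact div_nonneg (sinh_nonneg_iff.mpr hx) (cosh_pos x).le

/-- Up to time `T` the hyperbolic tangent `y` lies in `[0, 1)`, and `ξ + κ y = ξ (1 - y) + (ξ + κ)
y` is positive because `|κ| < ξ`; the remaining term is nonnegative since `θ ≤ 1`. -/
theorem localTax_denom_pos (δ ρ : ℝ) {η θ T t : ℝ} (hη : 0 < η) (hθ : 0 < θ) (hθ1 : θ ≤ 1)
    (ht : t ≤ T) :
    0 < θ * xi η δ ρ
      + (θ * kap η δ ρ + 2 * η ^ 2 * (1 - θ)) * tanh (xi η δ ρ * (T - t) / 2) := by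
  have hxi := xi_pos δ ρ hη
  have h0 : 0 ≤ tanh (xi η δ ρ * (T - t) / 2) :=
    tanh_nonneg (by have := mul_nonneg hxi.le (sub_nonneg.mpr ht); linarith)
  have h1 := (tanh_lt_one (xi η δ ρ * (T - t) / 2))
  set y := tanh (xi η δ ρ * (T - t) / 2)
  have hk := (abs_lt.mp (abs_kap_lt_xi η δ ρ hη)).1
  have h2 : 0 < xi η δ ρ + kap η δ ρ * y := by
    nlinarith [mul_pos hxi (sub_pos.mpr h1), mul_nonneg (neg_lt_iff_pos_add'.mp hk).le h0]
  have h3 : 0 ≤ 2 * η ^ 2 * (1 - θ) * y := by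
    have := sub_nonneg.mpr hθ1; positivity
  nlinarith [mul_pos hθ h2]

theorem hasDerivAt_tanh (x : ℝ) : HasDerivAt tanh (1 - tanh x ^ 2) x := by
  have h := (hasDerivAt_sinh x).div (hasDerivAt_cosh x) (cosh_pos x).ne'
  have he : (fun y => sinh y / cosh y) = tanh := by
    funext y; rw [tanh_eq_sinh_div_cosh]
  have hc := (cosh_pos x).ne'
  rw [show tanh = sinh / cosh from he.symm]
  convert! h using 1
  simp only [Pi.div_apply]
  field_simp

/-- The local tax solves the Riccati equation of the local control problem. -/
theorem hasDerivAt_localTax (δ ρ : ℝ) {η θ T t : ℝ} (hη : 0 < η) (hθ : 0 < θ) (hθ1 : θ ≤ 1)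
    (ht : t ≤ T) :
    HasDerivAt (localTax η δ ρ θ T)
      (η * localTax η δ ρ θ T t ^ 2 + kap η δ ρ * localTax η δ ρ θ T t - η) t := by
  have hD := (localTax_denom_pos δ ρ hη hθ hθ1 ht).ne'
  have hy : HasDerivAt (fun t => tanh (xi η δ ρ * (T - t) / 2))
      ((1 - tanh (xi η δ ρ * (T - t) / 2) ^ 2) * (-(xi η δ ρ) / 2)) t := by
    refine (hasDerivAt_tanh _).comp t ?_
    have := (((hasDerivAt_id t).const_sub T).const_mul (xi η δ ρ)).div_const 2
    simpa using this
  have h := (((hy.const_mul ((1 - θ) * kap η δ ρ - 2 * θ)).const_sub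
    ((1 - θ) * xi η δ ρ)).const_mul η).div ((hy.const_mul
      (θ * kap η δ ρ + 2 * η ^ 2 * (1 - θ))).const_add (θ * xi η δ ρ)) hD
  refine HasDerivAt.congr_deriv h ?_
  unfold localTax
  have hx := xi_sq η δ ρ
  set y := tanh (xi η δ ρ * (T - t) / 2)
  set X := xi η δ ρ
  set k := kap η δ ρ
  set D := θ * X + (θ * k + 2 * η ^ 2 * (1 - θ)) * y with hDd
  set N := (1 - θ) * X - ((1 - θ) * k - 2 * θ) * y with hN
  rw [div_eq_iff (pow_ne_zero 2 hD)]
  have : (η * (η * N / D) ^ 2 + k * (η * N / D) - η) * D ^ 2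
      = η * (η ^ 2 * N ^ 2 + k * N * D - D ^ 2) := by
    field_simp
  rw [this, hN, hDd]
  -- Both sides are polynomials in `y`. The coefficients of `1` and `y` agree outright; that of `y²`
  -- agrees once `ξ² = κ² + 4η²` is used.
  linear_combination (-η * y ^ 2 * (((1 - θ) * k - 2 * θ) * θ
    + (θ * k + 2 * η ^ 2 * (1 - θ)) * (1 - θ)) / 2) * hx

theorem continuousOn_localTax (δ ρ : ℝ) {η θ T : ℝ} (hη : 0 < η) (hθ : 0 < θ) (hθ1 : θ ≤ 1) :
    ContinuousOn (localTax η δ ρ θ T) (Icc 0 T) := fun _ ht =>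
  (hasDerivAt_localTax δ ρ hη hθ hθ1 ht.2).continuousAt.continuousWithinAt

/-- This is the transversality condition: it turns the boundary term of the value function at `T`
into the scrap cost. -/
theorem localTax_terminal (δ ρ T : ℝ) {η θ : ℝ} (hη : 0 < η) (hθ : 0 < θ) :
    localTax η δ ρ θ T T = η * ((1 - θ) / θ) := by
  have := (xi_pos δ ρ hη).ne'
  simp only [localTax, sub_self, mul_zero, zero_div, tanh_zero, sub_zero, add_zero]
  field_simp

/-! ### Verification and uniqueness of the optimal tax. -/

/-- Taken with `P = 1`, this also gives the continuity and the derivative of `growthFactor`. -/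
theorem isStockPath_localTax (δ ρ P : ℝ) {η θ T : ℝ} (hη : 0 < η) (hθ : 0 < θ) (hθ1 : θ ≤ 1) :
    IsStockPath η δ T P (localTax η δ ρ θ T) (fun t => P * growthFactor η δ ρ θ T t) where
  init := by simp [growthFactor]
  ode t ht := by
    have hc : ContinuousOn (fun s => η - δ - η * localTax η δ ρ θ T s) (Icc 0 T) :=
      continuousOn_const.sub (continuousOn_const.mul (continuousOn_localTax δ ρ hη hθ hθ1))
    have := ((hasDerivWithinAt_integral_Icc hc ht).exp).const_mul P
    convert! this using 1
    simp only [growthFactor]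
    ring

/-- Completing the square: the social cost of any tax is the minimal value plus a penalty for the
distance from the local tax. -/
theorem socialCost_eq (δ ρ P : ℝ) {η θ T : ℝ} (hη : 0 < η) (hθ : 0 < θ) (hθ1 : θ ≤ 1) (hT : 0 < T)
    {σ q : ℝ → ℝ} (hσ : ContinuousOn σ (Icc 0 T)) (hq : IsStockPath η δ T P σ q) :
    socialCost ρ θ T σ q = localTax η δ ρ θ T 0 / η * (P ^ 2 / 2) +
      ∫ t in (0 : ℝ)..T, q t ^ 2 * (σ t - localTax η δ ρ θ T t) ^ 2 / 2 * exp (-ρ * t) := by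
  have hqc : ContinuousOn q (Icc 0 T) := fun t ht => (hq.ode t ht).continuousWithinAt
  have hlc := continuousOn_localTax (T := T) δ ρ hη hθ hθ1
  have hec : ContinuousOn (fun t => exp (-ρ * t)) (Icc 0 T) := by fun_prop
  have i1 : IntervalIntegrable (fun t => q t ^ 2 * (1 + σ t ^ 2) / 2 * exp (-ρ * t))
      MeasureTheory.volume 0 T := by
    refine ContinuousOn.intervalIntegrable_of_Icc hT.le ?_
    fun_prop
  have i2 : IntervalIntegrable
      (fun t => q t ^ 2 * (σ t - localTax η δ ρ θ T t) ^ 2 / 2 * exp (-ρ * t))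
      MeasureTheory.volume 0 T := by
    refine ContinuousOn.intervalIntegrable_of_Icc hT.le ?_
    fun_prop
  -- The derivative of the value function along the path is the squared penalty minus the running
  -- cost; the Riccati equation cancels every other term.
  have ftc := intervalIntegral.integral_eq_sub_of_hasDerivAt_of_le hT.le
    (f := fun t => localTax η δ ρ θ T t * q t ^ 2 * exp (-ρ * t) / (2 * η))
    (f' := fun t => q t ^ 2 * (σ t - localTax η δ ρ θ T t) ^ 2 / 2 * exp (-ρ * t)
      - q t ^ 2 * (1 + σ t ^ 2) / 2 * exp (-ρ * t)) (by fun_prop)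
    (fun t ht => by
      have h1 := (hq.ode t (Ioo_subset_Icc_self ht)).hasDerivAt (Icc_mem_nhds ht.1 ht.2)
      have h2 := hasDerivAt_localTax δ ρ hη hθ hθ1 ht.2.le
      have h3 : HasDerivAt (fun t => exp (-ρ * t)) (exp (-ρ * t) * (-ρ)) t := by
        simpa using ((hasDerivAt_id t).const_mul (-ρ)).exp
      have := ((h2.mul (h1.pow 2)).mul h3).div_const (2 * η)
      refine HasDerivAt.congr_deriv this ?_
      simp only [Pi.mul_apply, Pi.pow_apply, kap]
      field_simp
      ring)
    (i2.sub i1)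
  rw [intervalIntegral.integral_sub i2 i1] at ftc
  rw [socialCost]
  simp only [hq.init, localTax_terminal δ ρ T hη hθ, mul_zero, exp_zero] at ftc
  have : η * ((1 - θ) / θ) * q T ^ 2 * exp (-ρ * T) / (2 * η)
      = (1 - θ) / θ * (q T ^ 2 / 2) * exp (-ρ * T) := by field_simp
  rw [this] at ftc
  have : localTax η δ ρ θ T 0 * P ^ 2 * 1 / (2 * η)
    = localTax η δ ρ θ T 0 / η * (P ^ 2 / 2) := by field_simp
  rw [this] at ftc
  linarith

theorem isOptimalTax_localTax (δ ρ P : ℝ) {η θ T : ℝ} (hη : 0 < η) (hθ : 0 < θ) (hθ1 : θ ≤ 1)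
    (hT : 0 < T) : IsOptimalTax η δ ρ θ T P (localTax η δ ρ θ T) where
  cont := continuousOn_localTax δ ρ hη hθ hθ1
  minimal := by
    refine ⟨_, isStockPath_localTax δ ρ P hη hθ hθ1, fun σ q hσ hq => ?_⟩
    rw [socialCost_eq δ ρ P hη hθ hθ1 hT hσ hq, socialCost_eq δ ρ P hη hθ hθ1 hT
      (continuousOn_localTax δ ρ hη hθ hθ1) (isStockPath_localTax δ ρ P hη hθ hθ1)]
    simp only [sub_self, ne_eq, OfNat.ofNat_ne_zero, not_false_eq_true, zero_pow, mul_zero,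
      zero_div, zero_mul, intervalIntegral.integral_zero, add_zero]
    refine le_add_of_nonneg_right (intervalIntegral.integral_nonneg hT.le fun t _ => ?_)
    positivity

/-- The local tax is the only optimal tax. -/
theorem IsOptimalTax.eq_localTax {η δ ρ θ T P : ℝ} {τ : ℝ → ℝ} (hη : 0 < η) (hθ : 0 < θ)
    (hθ1 : θ ≤ 1) (hT : 0 < T) (hP : P ≠ 0) (h : IsOptimalTax η δ ρ θ T P τ) {t : ℝ}
    (ht : t ∈ Icc 0 T) : τ t = localTax η δ ρ θ T t := by
  obtain ⟨q, hq, hmin⟩ := h.minimal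
  have hlc := continuousOn_localTax (T := T) δ ρ hη hθ hθ1
  have hτ := h.cont
  have hle := hmin _ _ hlc (isStockPath_localTax δ ρ P hη hθ hθ1)
  rw [socialCost_eq δ ρ P hη hθ hθ1 hT hτ hq, socialCost_eq δ ρ P hη hθ hθ1 hT
      hlc (isStockPath_localTax δ ρ P hη hθ hθ1)] at hle
  simp only [sub_self, ne_eq, OfNat.ofNat_ne_zero, not_false_eq_true, zero_pow, mul_zero,
      zero_div, zero_mul, intervalIntegral.integral_zero, add_zero] at hle
  have hqc : ContinuousOn q (Icc 0 T) := fun t ht => (hq.ode t ht).continuousWithinAt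
  have hc : ContinuousOn (fun t => q t ^ 2 * (τ t - localTax η δ ρ θ T t) ^ 2 / 2 * exp (-ρ * t))
      (Icc 0 T) := by fun_prop
  by_contra hne
  -- The penalty carries the weight `q²`, so it detects a deviation at `t` only if the stock is
  -- nonzero there.
  have hqt : q t ≠ 0 := by
    rw [eq_exp_integral_of_hasDerivWithinAt hT (a := fun t => η * (1 - τ t) - δ) (by fun_prop)
      hq.ode ht, hq.init]
    exact mul_ne_zero hP (exp_pos _).ne'
  have hpos : 0 < ∫ t in (0 : ℝ)..T,
      q t ^ 2 * (τ t - localTax η δ ρ θ T t) ^ 2 / 2 * exp (-ρ * t) := by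
    refine intervalIntegral.integral_pos hT hc (fun s _ => by positivity) ⟨t, ht, ?_⟩
    have := sub_ne_zero.mpr hne
    positivity
  linarith

/-! ### Cosine series of a `C¹` function. -/

open Complex in
/-- The cosine coefficients are Fourier coefficients of the even reflection. -/
theorem fourierCoeffOn_even {L : ℝ} (hL : -L < L) (hL0 : 0 < L) {g : ℝ → ℝ}
    (hg : Continuous g) (n : ℤ) :
    fourierCoeffOn hL (fun y => (g |y| : ℂ)) n =
      ((1 / L * ∫ y in (0 : ℝ)..L, g y * Real.cos (n * π * (y / L)) : ℝ) : ℂ) := by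
  have hf : ∀ y : ℝ, (fourier (-n) (y : AddCircle (L - -L)) : ℂ)
      = Real.cos (n * π * (y / L)) - Real.sin (n * π * (y / L)) * I := by
    intro y
    have h2 : (L : ℂ) ≠ 0 := Complex.ofReal_ne_zero.mpr hL0.ne'
    have : 2 * (π : ℂ) * I * ((-n : ℤ) : ℂ) * y / ((L - -L : ℝ) : ℂ)
        = ((-(n * π * (y / L)) : ℝ) : ℂ) * I := by
      push_cast
      field_simp
      ring
    rw [fourier_coe_apply, this, Complex.exp_ofReal_mul_I, Real.cos_neg, Real.sin_neg]
    push_cast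
    ring
  have hc : Continuous fun y : ℝ => g |y| := hg.comp continuous_abs
  rw [fourierCoeffOn_eq_integral]
  simp only [smul_eq_mul, hf]
  have i1 : ∀ a b, IntervalIntegrable (fun y : ℝ => ((Real.cos (n * π * (y / L)) : ℂ)
      - Real.sin (n * π * (y / L)) * I) * (g |y| : ℂ)) MeasureTheory.volume a b := by
    intro a b
    refine Continuous.intervalIntegrable ?_ _ _
    fun_prop
  -- Folding `[-L, 0]` onto `[0, L]` cancels the sines and doubles the cosines.
  rw [← intervalIntegral.integral_add_adjacent_intervals (i1 (-L) 0) (i1 0 L),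
    ← neg_zero, ← intervalIntegral.integral_comp_neg, neg_zero,
    ← intervalIntegral.integral_add]
  · have : ∀ y ∈ uIcc 0 L,
       ((Real.cos (n * π * (-y / L)) : ℂ)
      - Real.sin (n * π * (-y / L)) * I) * (g |-y| : ℂ) + ((Real.cos (n * π * (y / L)) : ℂ)
      - Real.sin (n * π * (y / L)) * I) * (g |y| : ℂ) = ((2 * (g y * Real.cos (n * π * (y / L))) : ℝ) : ℂ) := by
      intro y hy
      rw [uIcc_of_le hL0.le] at hy
      rw [abs_neg, abs_of_nonneg hy.1, neg_div, mul_neg, Real.cos_neg, Real.sin_neg]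
      push_cast
      ring
    rw [intervalIntegral.integral_congr this, intervalIntegral.integral_ofReal,
      intervalIntegral.integral_const_mul, Complex.real_smul, ← Complex.ofReal_mul]
    congr 1
    field_simp
    ring
  · exact Continuous.intervalIntegrable (by fun_prop) _ _
  · exact i1 0 L

/-- The coefficient is moved to `[0, xb - xa]` and written with an extension `P` of `p0`, since the
reflection lemma needs a function continuous on the whole line. -/
theorem cosCoeff_eq {xa xb : ℝ} (hx : xa < xb) {p0 P : ℝ → ℝ}
    (hP : ∀ x ∈ Icc xa xb, P x = p0 x) (n : ℕ) :
    cosCoeff xa xb p0 n = 2 * (1 / (xb - xa) *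
      ∫ y in (0 : ℝ)..(xb - xa), P (xa + y) * cos (n * π * (y / (xb - xa)))) := by
  have := intervalIntegral.integral_comp_add_left
    (fun x => P x * cos (n * π * ((x - xa) / (xb - xa)))) xa (a := 0) (b := xb - xa)
  simp only [add_sub_cancel_left, add_zero, add_sub_cancel] at this
  rw [this, cosCoeff, ← mul_assoc, mul_one_div]
  congr 1
  refine intervalIntegral.integral_congr fun x hxx => ?_
  rw [uIcc_of_le hx.le] at hxx
  simp only [hP x hxx, cosMode]

/-- The Fourier coefficients of the even reflection of a `C¹` function are summable. -/
theorem summable_fourierCoeffOn_even {L : ℝ} (hL : -L < L) (hL0 : 0 < L) {g g' : ℝ → ℝ}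
    (hg : Continuous g) (hg' : Continuous g') (hb : ∃ C, ∀ y, |g' y| ≤ C)
    (hd : ∀ y ∈ Ioo 0 L, HasDerivAt g (g' y) y) (hd₀ : HasDerivWithinAt g (g' 0) (Ioi 0) 0) :
    Summable (fourierCoeffOn hL (fun y => (g |y| : ℂ))) := by
  obtain ⟨C, hC⟩ := hb
  -- the derivative of the reflection
  set F' : ℝ → ℝ := fun y => if y < 0 then -g' (-y) else g' y with hF'
  have hm : Measurable F' := Measurable.ite measurableSet_Iio (by fun_prop) (by fun_prop)
  have hbd : ∀ y, |F' y| ≤ C := by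
    intro y
    simp only [hF']
    split_ifs
    · rw [abs_neg]; exact hC _
    · exact hC _
  have hd0 : ∀ y ∈ Ico 0 L, HasDerivWithinAt g (g' y) (Ioi y) y := by
    intro y hy
    rcases eq_or_lt_of_le hy.1 with h0 | h0
    · subst h0
      exact hd₀
    · exact (hd y ⟨h0, hy.2⟩).hasDerivWithinAt
  -- The reflection may have a kink at `0`; right derivatives exist there too, and they suffice for
  -- integration by parts.
  have hR : ∀ y ∈ Ioo (-L) L, HasDerivWithinAt (fun y => (g |y| : ℂ)) (F' y : ℂ) (Ioi y) y := by
    intro y hy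
    refine HasDerivWithinAt.ofReal_comp (f := fun y => g |y|) ?_
    simp only [hF']
    split_ifs with h
    · have h1 := (hd (-y) ⟨by linarith, by linarith [hy.1]⟩).comp y (hasDerivAt_neg y)
      have h2 : HasDerivAt (fun y => g |y|) (-g' (-y)) y := by
        refine (h1.congr_of_eventuallyEq ?_).congr_deriv (by ring)
        filter_upwards [Iio_mem_nhds h] with z hz
        simp [abs_of_neg (mem_Iio.mp hz)]
      exact h2.hasDerivWithinAt
    · have h' := not_lt.mp h
      refine (hd0 y ⟨h', hy.2⟩).congr (fun z hz => ?_) (by rw [abs_of_nonneg h'])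
      rw [abs_of_pos (h'.trans_lt hz)]
  have hint : IntervalIntegrable (fun y => (F' y : ℂ)) MeasureTheory.volume (-L) L := by
    rw [intervalIntegrable_iff_integrableOn_Ioc_of_le hL.le]
    exact (MeasureTheory.memLp_one_iff_integrable).mp (MeasureTheory.MemLp.of_bound
      (by fun_prop) C (Filter.Eventually.of_forall fun y => by simpa using hbd y))
  -- Integration by parts: the boundary term vanishes because the reflection takes equal values at
  -- `-L` and `L`.
  have hco : ∀ n : ℤ, n ≠ 0 → ‖fourierCoeffOn hL (fun y => (g |y| : ℂ)) n‖ =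
      L / π * (|(n : ℝ)|⁻¹ * ‖fourierCoeffOn hL (fun y => (F' y : ℂ)) n‖) := by
    intro n hn
    rw [fourierCoeffOn_of_hasDeriv_right hL hn (f' := fun y => (F' y : ℂ)) (by fun_prop)
      (fun y hy => hR y (by rwa [min_eq_left hL.le, max_eq_right hL.le] at hy)) hint]
    simp only [abs_neg, sub_self, mul_zero, zero_sub, norm_mul, norm_neg]
    rw [← Complex.ofReal_sub, Complex.norm_real, norm_eq_abs, abs_of_pos (by linarith)]
    simp only [one_div, norm_inv, norm_mul, norm_neg, Complex.norm_ofNat, Complex.norm_real,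
      Complex.norm_I, Complex.norm_intCast, norm_eq_abs, abs_of_pos pi_pos]
    field_simp
    ring
  have hsq : Summable fun n : ℤ => ‖fourierCoeffOn hL (fun y => (F' y : ℂ)) n‖ ^ 2 := by
    refine (hasSum_sq_fourierCoeffOn hL (MeasureTheory.MemLp.of_bound
      (by fun_prop) C (Filter.Eventually.of_forall fun y => by simpa using hbd y))).summable
  have hsn : Summable fun n : ℤ => |(n : ℝ)|⁻¹ ^ 2 := by
    simpa using Real.summable_one_div_int_pow.mpr one_lt_two
  refine Summable.of_norm ?_
  -- The product of `1/|n|` and the coefficient of the derivative is at most the sum of their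
  -- squares, summable by Parseval and `∑ 1/n²`. The index `0` is discarded.
  refine Summable.of_norm_bounded_eventually ((hsq.add hsn).mul_left (L / π)) ?_
  filter_upwards [(Set.finite_singleton (0 : ℤ)).compl_mem_cofinite] with n hn
  rw [norm_norm, hco n hn]
  gcongr
  nlinarith [sq_nonneg (‖fourierCoeffOn hL (fun y => (F' y : ℂ)) n‖ - |(n : ℝ)|⁻¹),
    sq_nonneg (‖fourierCoeffOn hL (fun y => (F' y : ℂ)) n‖), sq_nonneg |(n : ℝ)|⁻¹]

/-- A `C¹` function is the sum of its cosine series, which converges absolutely. -/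
theorem cosSeries {xa xb : ℝ} (hx : xa < xb) {p0 : ℝ → ℝ} (hp0 : ContDiffOn ℝ 1 p0 (Icc xa xb)) :
    Summable (fun n : ℕ => |cosCoeff xa xb p0 (n + 1)|) ∧
    ∀ x ∈ Icc xa xb, HasSum (fun n : ℕ => cosCoeff xa xb p0 (n + 1) * cosMode xa xb (n + 1) x)
      (p0 x - cosCoeff xa xb p0 0 / 2) := by
  set L := xb - xa with hLd
  have hL0 : 0 < L := sub_pos.mpr hx
  have hL : -L < L := by linarith
  have hF : Fact (0 < L - -L) := ⟨by linarith⟩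
  set P := IccExtend hx.le (fun x : Icc xa xb => p0 x)
  set D := IccExtend hx.le (fun x : Icc xa xb => derivWithin p0 (Icc xa xb) x)
  have hPe : ∀ x ∈ Icc xa xb, P x = p0 x := fun x hxx => IccExtend_of_mem hx.le _ hxx
  have hDe : ∀ x ∈ Icc xa xb, D x = derivWithin p0 (Icc xa xb) x :=
    fun x hxx => IccExtend_of_mem hx.le _ hxx
  have hPc : Continuous P :=
    Continuous.Icc_extend' (continuousOn_iff_continuous_domRestrict.mp hp0.continuousOn)
  have hDco := hp0.continuousOn_derivWithin (uniqueDiffOn_Icc hx) le_rfl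
  have hDc : Continuous D :=
    Continuous.Icc_extend' (continuousOn_iff_continuous_domRestrict.mp hDco)
  have hDb : ∃ C, ∀ y, |D (xa + y)| ≤ C := by
    obtain ⟨C, hC⟩ := isCompact_Icc.exists_bound_of_continuousOn hDco
    exact ⟨C, fun y => hC _ (projIcc xa xb hx.le (xa + y)).2⟩
  have hsum := summable_fourierCoeffOn_even hL hL0 (g := fun y => P (xa + y))
    (g' := fun y => D (xa + y)) (by fun_prop) (by fun_prop) hDb (fun y hy => by
      have hm : xa + y ∈ Ioo xa xb := ⟨by linarith [hy.1], by linarith [hy.2]⟩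
      have h1 := ((hp0.differentiableOn one_ne_zero _ (Ioo_subset_Icc_self hm)).hasDerivWithinAt).hasDerivAt
        (Icc_mem_nhds hm.1 hm.2)
      rw [← hDe _ (Ioo_subset_Icc_self hm)] at h1
      have h2 : HasDerivAt P (D (xa + y)) (xa + y) := by
        refine h1.congr_of_eventuallyEq ?_
        filter_upwards [Icc_mem_nhds hm.1 hm.2] with z hz using hPe z hz
      exact h2.comp_const_add xa y) (by
      have hm := left_mem_Icc.mpr hx.le
      have h1 := (hp0.differentiableOn one_ne_zero _ hm).hasDerivWithinAt
      rw [← hDe _ hm] at h1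
      have h2 : HasDerivWithinAt P (D xa) (Ioi xa) xa :=
        (h1.congr hPe (hPe _ hm)).mono_of_mem_nhdsWithin (Icc_mem_nhdsGT hx)
      have h3 : HasDerivWithinAt (fun y => P (xa + y)) _ _ _ := HasDerivWithinAt.comp (h₂ := P) (h := fun y => xa + y) (s := Ioi 0)
        (s' := Ioi xa) (h₂' := D (xa + 0)) (h' := 1) (0 : ℝ) (by simpa using h2)
        (((hasDerivAt_id (0 : ℝ)).const_add xa).hasDerivWithinAt)
        (fun y hy => by simpa using hy)
      simpa only [add_zero, mul_one] using h3)
  have hco : ∀ n : ℤ, fourierCoeffOn hL (fun y => (P (xa + |y|) : ℂ)) n =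
      ((cosCoeff xa xb p0 n.natAbs / 2 : ℝ) : ℂ) := by
    intro n
    rw [fourierCoeffOn_even hL hL0 (g := fun y => P (xa + y)) (by fun_prop), cosCoeff_eq hx hPe]
    rw [mul_div_cancel_left₀ _ (two_ne_zero), Nat.cast_natAbs]
    congr 3
    funext y
    rw [hLd]
    rcases abs_choice n with h | h <;> rw [h]
    push_cast
    rw [neg_mul, neg_mul, cos_neg]
  have hs1 : Summable fun n : ℕ => fourierCoeffOn hL (fun y => (P (xa + |y|) : ℂ)) (n + 1) :=
    hsum.comp_injective (i := fun n : ℕ => (n : ℤ) + 1) fun a b h => by simpa using h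
  refine ⟨?_, fun x hxx => ?_⟩
  · have := hs1.norm.mul_left 2
    refine this.congr fun n => ?_
    have e : ((n : ℤ) + 1).natAbs = n + 1 := by omega
    rw [hco, e, Complex.norm_real, norm_eq_abs, abs_div]
    norm_num
    ring
  · have hcont : Continuous (AddCircle.liftIco (L - -L) (-L) (fun y => (P (xa + |y|) : ℂ))) := by
      refine AddCircle.liftIco_continuous ?_ (by fun_prop)
      simp
    have hcoe : ∀ n : ℤ, fourierCoeff (AddCircle.liftIco (L - -L) (-L)
        (fun y => (P (xa + |y|) : ℂ))) n = ((cosCoeff xa xb p0 n.natAbs / 2 : ℝ) : ℂ) := by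
      intro n
      rw [← hco n, fourierCoeff_liftIco_eq]
      simp only [add_sub_cancel]
    -- The evaluation point is `-(x - xa)`, not `x - xa`: the fundamental domain `[-L, L)` omits
    -- `L`, which would exclude `x = xb`, and the reflection is even.
    have h := has_pointwise_sum_fourier_series_of_summable
      (f := ⟨_, hcont⟩) (by
        refine hsum.congr fun n => ?_
        rw [hco]; exact (hcoe n).symm) ((-(x - xa) : ℝ) : AddCircle (L - -L))
    have hy : -(x - xa) ∈ Ico (-L) (-L + (L - -L)) := ⟨by linarith [hxx.2], by linarith [hxx.1]⟩
    -- Pairing `n` with `-n` counts the index `0` twice. Removing that pair, which equals the full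
    -- `A₀`, leaves `p0 x - A₀/2`.
    have h1 := h.nat_add_neg
    simp only [ContinuousMap.coe_mk] at h1
    rw [AddCircle.liftIco_coe_apply hy] at h1
    simp only [hcoe] at h1
    rw [← hasSum_nat_add_iff' 1] at h1
    simp only [abs_neg, abs_of_nonneg (sub_nonneg.mpr hxx.1), add_sub_cancel, hPe x hxx,
      Finset.range_one, Finset.sum_singleton, Int.natAbs_neg, Int.natAbs_natCast] at h1
    rw [← Complex.hasSum_ofReal]
    convert! h1 using 1
    · funext n
      have h2 : (L : ℂ) ≠ 0 := Complex.ofReal_ne_zero.mpr hL0.ne'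
      have h3 : 2 * (π : ℂ) * Complex.I * (((n + 1 : ℕ) : ℤ) : ℂ) * ((-(x - xa) : ℝ) : ℂ)
          / ((L - -L : ℝ) : ℂ)
          = ((-(((n + 1 : ℕ) : ℝ) * π * ((x - xa) / L)) : ℝ) : ℂ) * Complex.I := by
        push_cast
        field_simp
        ring
      have h4 : 2 * (π : ℂ) * Complex.I * ((-((n + 1 : ℕ) : ℤ) : ℤ) : ℂ) * ((-(x - xa) : ℝ) : ℂ)
          / ((L - -L : ℝ) : ℂ)
          = (((((n + 1 : ℕ) : ℝ) * π * ((x - xa) / L)) : ℝ) : ℂ) * Complex.I := by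
        push_cast
        field_simp
        ring
      rw [fourier_coe_apply, fourier_coe_apply, h3, h4, Complex.exp_ofReal_mul_I,
        Complex.exp_ofReal_mul_I, cos_neg, sin_neg, cosMode, ← hLd]
      push_cast
      simp only [smul_eq_mul]
      ring
    · simp
      ring

/-! ### Maximum principle and uniqueness for the Neumann problem. -/

open Filter Topology in
/-- The second derivative is nonpositive at a local maximum. -/
theorem IsLocalMax.second_deriv_nonpos {f f' : ℝ → ℝ} {f'' x : ℝ} (h : IsLocalMax f x)
    (hf : ∀ᶠ y in 𝓝 x, HasDerivAt f (f' y) y) (hf' : HasDerivAt f' f'' x) : f'' ≤ 0 := by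
  by_contra! hpos
  have he : deriv f =ᶠ[𝓝 x] f' := hf.mono fun y hy => hy.deriv
  have hdd : deriv (deriv f) x = f'' := by rw [he.deriv_eq, hf'.deriv]
  -- A positive second derivative would make the point a local minimum too, so `f` would be locally
  -- constant and the second derivative zero.
  have hmin := isLocalMin_of_deriv_deriv_pos (by rw [hdd]; exact hpos) h.deriv_eq_zero
    hf.self_of_nhds.continuousAt
  have hc : f =ᶠ[𝓝 x] fun _ => f x := by
    filter_upwards [h, hmin] with y h1 h2 using le_antisymm h1 h2
  have h0 : deriv f =ᶠ[𝓝 x] fun _ => 0 := by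
    filter_upwards [hc.eventuallyEq_nhds] with y hy
    rw [hy.deriv_eq, deriv_const]
  rw [h0.deriv_eq, deriv_const] at hdd
  exact hpos.ne hdd

/-- At a maximum over a convex set, the derivative points outwards. -/
theorem IsMaxOn.hasDerivWithinAt_mul_nonpos {f : ℝ → ℝ} {f' x y : ℝ} {s : Set ℝ} (hs : Convex ℝ s)
    (h : IsMaxOn f s x) (hx : x ∈ s) (hy : y ∈ s) (hf : HasDerivWithinAt f f' s x) :
    (y - x) * f' ≤ 0 := by
  have := (h.localize).hasFDerivWithinAt_nonpos hf.hasFDerivWithinAt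
    (y := y - x) (mem_posTangentConeAt_of_segment_subset (by
      rw [add_sub_cancel]; exact hs.segment_subset hx hy))
  simpa using this

/-- `v` solves the heat equation `∂v/∂t = d ∂²v/∂x²` with Neumann boundary conditions; `vx` and
`vxx` are its space derivatives. -/
structure IsHeatSolution (T d xa xb : ℝ) (v vx vxx : ℝ → ℝ → ℝ) : Prop where
  cont : ContinuousOn (fun z : ℝ × ℝ => v z.1 z.2) (Icc xa xb ×ˢ Icc 0 T)
  deriv_x : ∀ x ∈ Ioo xa xb, ∀ t ∈ Ioo 0 T, HasDerivAt (fun y => v y t) (vx x t) x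
  deriv_xx : ∀ x ∈ Ioo xa xb, ∀ t ∈ Ioo 0 T, HasDerivAt (fun y => vx y t) (vxx x t) x
  deriv_t : ∀ x ∈ Ioo xa xb, ∀ t ∈ Ioo 0 T, HasDerivAt (fun s => v x s) (d * vxx x t) t
  neumann : ∀ x ∈ ({xa, xb} : Set ℝ), ∀ t ∈ Ioo 0 T,
    HasDerivWithinAt (fun y => v y t) 0 (Icc xa xb) x

namespace IsHeatSolution

variable {T d xa xb : ℝ} {v vx vxx w wx wxx : ℝ → ℝ → ℝ}

theorem sub (hv : IsHeatSolution T d xa xb v vx vxx) (hw : IsHeatSolution T d xa xb w wx wxx) :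
    IsHeatSolution T d xa xb (fun x t => v x t - w x t) (fun x t => vx x t - wx x t)
      (fun x t => vxx x t - wxx x t) where
  cont := hv.cont.sub hw.cont
  deriv_x x hx t ht := (hv.deriv_x x hx t ht).sub (hw.deriv_x x hx t ht)
  deriv_xx x hx t ht := (hv.deriv_xx x hx t ht).sub (hw.deriv_xx x hx t ht)
  deriv_t x hx t ht := by
    rw [mul_sub]
    exact (hv.deriv_t x hx t ht).sub (hw.deriv_t x hx t ht)
  neumann x hx t ht := by simpa using! (hv.neumann x hx t ht).sub (hw.neumann x hx t ht)

/-- The maximum principle. -/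
theorem nonpos (hv : IsHeatSolution T d xa xb v vx vxx) (hxx : xa < xb) (hd : 0 ≤ d)
    (h0 : ∀ x ∈ Icc xa xb, v x 0 ≤ 0) {x t : ℝ} (hx : x ∈ Icc xa xb) (ht : t ∈ Ico 0 T) :
    v x t ≤ 0 := by
  by_contra! hpos
  set m := (xa + xb) / 2 with hm
  -- a barrier with outward decreasing normal derivative
  obtain ⟨ε, hε, hzpos⟩ : ∃ ε > 0, 0 < v x t - ε * ((2 * d + 1) * t + (x - m) ^ 2) := by
    have hB : 0 ≤ (2 * d + 1) * t + (x - m) ^ 2 := by have := ht.1; positivity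
    refine ⟨v x t / ((2 * d + 1) * t + (x - m) ^ 2 + 1), by positivity, ?_⟩
    rw [div_mul_eq_mul_div, sub_pos, div_lt_iff₀ (by positivity)]
    nlinarith
  set z : ℝ × ℝ → ℝ := fun q => v q.1 q.2 - ε * ((2 * d + 1) * q.2 + (q.1 - m) ^ 2) with hz
  have hzc : ContinuousOn z (Icc xa xb ×ˢ Icc 0 t) := by
    refine ContinuousOn.sub (hv.cont.mono (prod_mono le_rfl (Icc_subset_Icc le_rfl ht.2.le))) ?_
    fun_prop
  -- Stopping at `t < T` keeps the maximum at a time where the equation holds, even when it sits on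
  -- the top edge `s = t`.
  obtain ⟨⟨y, s⟩, ⟨hy, hs⟩, hmax⟩ := (isCompact_Icc.prod isCompact_Icc).exists_isMaxOn
    ⟨(x, t), hx, right_mem_Icc.mpr ht.1⟩ hzc
  dsimp only at hy hs
  have hzys : 0 < z (y, s) := hzpos.trans_le (hmax ⟨hx, right_mem_Icc.mpr ht.1⟩)
  have hs0 : 0 < s := by
    refine lt_of_le_of_ne hs.1 fun hs0 => ?_
    subst hs0
    have := h0 y hy
    simp only [hz, mul_zero, zero_add] at hzys
    have : 0 ≤ ε * (y - m) ^ 2 := by positivity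
    linarith
  have hsT : s ∈ Ioo 0 T := ⟨hs0, hs.2.trans_lt ht.2⟩
  have hmx : IsMaxOn (fun y => z (y, s)) (Icc xa xb) y := fun y' hy' => hmax ⟨hy', hs⟩
  have hmt : IsMaxOn (fun s => z (y, s)) (Icc 0 s) s :=
    fun s' hs' => hmax ⟨hy, hs'.1, hs'.2.trans hs.2⟩
  have hbx : ∀ y, HasDerivAt (fun y => ε * ((2 * d + 1) * s + (y - m) ^ 2)) (ε * (2 * (y - m))) y := by
    intro y
    have := (((((hasDerivAt_id y).sub_const m).pow 2)).const_add ((2 * d + 1) * s)).const_mul ε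
    simpa using! this
  have hbd : ∀ e ∈ ({xa, xb} : Set ℝ), HasDerivWithinAt (fun y => z (y, s))
      (0 - ε * (2 * (e - m))) (Icc xa xb) e := fun e he =>
    (hv.neumann e he s hsT).sub (hbx e).hasDerivWithinAt
  -- The barrier makes the inward slope strictly positive at both ends, which excludes a maximum
  -- there.
  have hya : y ≠ xa := by
    rintro rfl
    have := hmx.hasDerivWithinAt_mul_nonpos (convex_Icc _ _) hy (right_mem_Icc.mpr hxx.le)
      (hbd y (by simp))
    have h1 : 0 < (xb - y) * (ε * (2 * (m - y))) := by
      have : 0 < m - y := by rw [hm]; linarith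
      have := sub_pos.mpr hxx
      positivity
    nlinarith
  have hyb : y ≠ xb := by
    rintro rfl
    have := hmx.hasDerivWithinAt_mul_nonpos (convex_Icc _ _) hy (left_mem_Icc.mpr hxx.le)
      (hbd y (by simp))
    have h1 : 0 < (y - xa) * (ε * (2 * (y - m))) := by
      have : 0 < y - m := by rw [hm]; linarith
      have := sub_pos.mpr hxx
      positivity
    nlinarith
  have hyI : y ∈ Ioo xa xb := ⟨lt_of_le_of_ne hy.1 hya.symm, lt_of_le_of_ne hy.2 hyb⟩
  have hxx2 : vxx y s - ε * 2 ≤ 0 := by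
    refine IsLocalMax.second_deriv_nonpos (f := fun y => z (y, s))
      (f' := fun y => vx y s - ε * (2 * (y - m)))
      (hmx.isLocalMax (Icc_mem_nhds hyI.1 hyI.2)) ?_ ?_
    · filter_upwards [Ioo_mem_nhds hyI.1 hyI.2] with y' hy'
      exact (hv.deriv_x y' hy' s hsT).sub (hbx y')
    · refine (hv.deriv_xx y hyI s hsT).sub ?_
      simpa using (((hasDerivAt_id y).sub_const m).const_mul 2).const_mul ε
  have hts : (0 - s) * (d * vxx y s - ε * (2 * d + 1)) ≤ 0 := by
    refine hmt.hasDerivWithinAt_mul_nonpos (convex_Icc _ _) (right_mem_Icc.mpr hs0.le)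
      (left_mem_Icc.mpr hs0.le) (HasDerivAt.hasDerivWithinAt ?_)
    refine (hv.deriv_t y hyI s hsT).sub ?_
    simpa using (((hasDerivAt_id s).const_mul (2 * d + 1)).add_const ((y - m) ^ 2)).const_mul ε
  -- From `vxx ≤ 2ε`, the time derivative is at most `2dε - ε(2d + 1) = -ε`, while a maximum over
  -- `[0, s]` at `s` needs it nonnegative. This is the reason for the slope `2d + 1`.
  have h3 : d * vxx y s - ε * (2 * d + 1) < 0 := by nlinarith
  nlinarith

/-- Solutions of the Neumann problem are determined by their initial values. -/
theorem eq_of_initial (hv : IsHeatSolution T d xa xb v vx vxx)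
    (hw : IsHeatSolution T d xa xb w wx wxx) (hxx : xa < xb) (hd : 0 ≤ d) (hT : 0 < T)
    (h0 : ∀ x ∈ Icc xa xb, v x 0 = w x 0) {x t : ℝ} (hx : x ∈ Icc xa xb) (ht : t ∈ Icc 0 T) :
    v x t = w x t := by
  have key : EqOn (fun t => v x t) (fun t => w x t) (Ico 0 T) := fun t ht =>
    le_antisymm
      (sub_nonpos.mp ((hv.sub hw).nonpos hxx hd (fun y hy => (sub_eq_zero.mpr (h0 y hy)).le) hx ht))
      (sub_nonpos.mp ((hw.sub hv).nonpos hxx hd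
        (fun y hy => (sub_eq_zero.mpr (h0 y hy).symm).le) hx ht))
  have hm : MapsTo (fun s : ℝ => (x, s)) (Icc 0 T) (Icc xa xb ×ˢ Icc 0 T) := fun s hs => ⟨hx, hs⟩
  -- The final time is reached by continuity.
  exact key.of_subset_closure (hv.cont.comp (by fun_prop) hm) (hw.cont.comp (by fun_prop) hm)
    Ico_subset_Icc_self (by rw [closure_Ico hT.ne]) ht

end IsHeatSolution

/-! ### Single modes: derivatives and bounds. -/

/-- The sine `sin (k π (x - xa) / (xb - xa))`. -/
noncomputable def sinMode (xa xb : ℝ) (k : ℕ) (x : ℝ) : ℝ := sin (k * π * ((x - xa) / (xb - xa)))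

/-- The space derivative of `heatTerm`. -/
noncomputable def heatTermX (d xa xb : ℝ) (p0 : ℝ → ℝ) (x t : ℝ) (k : ℕ) : ℝ :=
  cosCoeff xa xb p0 k * exp (-d * (k * π / (xb - xa)) ^ 2 * t) *
    (-(k * π / (xb - xa)) * sinMode xa xb k x)

/-- The second space derivative of `heatTerm`. -/
noncomputable def heatTermXX (d xa xb : ℝ) (p0 : ℝ → ℝ) (x t : ℝ) (k : ℕ) : ℝ :=
  cosCoeff xa xb p0 k * exp (-d * (k * π / (xb - xa)) ^ 2 * t) *
    (-(k * π / (xb - xa)) ^ 2 * cosMode xa xb k x)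

theorem hasDerivAt_cosMode (xa xb : ℝ) (k : ℕ) (x : ℝ) :
    HasDerivAt (cosMode xa xb k) (-(k * π / (xb - xa)) * sinMode xa xb k x) x := by
  have := ((((hasDerivAt_id x).sub_const xa).div_const (xb - xa)).const_mul ((k : ℝ) * π)).cos
  refine HasDerivAt.congr_deriv this ?_
  simp only [id, sinMode]; ring

theorem hasDerivAt_sinMode (xa xb : ℝ) (k : ℕ) (x : ℝ) :
    HasDerivAt (sinMode xa xb k) (k * π / (xb - xa) * cosMode xa xb k x) x := by
  have := ((((hasDerivAt_id x).sub_const xa).div_const (xb - xa)).const_mul ((k : ℝ) * π)).sin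
  refine HasDerivAt.congr_deriv this ?_
  simp only [id, cosMode]; ring

section HeatTerm

variable (d xa xb : ℝ) (p0 : ℝ → ℝ)

theorem hasDerivAt_heatTerm (k : ℕ) (x t : ℝ) :
    HasDerivAt (fun y => heatTerm d xa xb p0 y t k) (heatTermX d xa xb p0 x t k) x :=
  (hasDerivAt_cosMode xa xb k x).const_mul _

theorem hasDerivAt_heatTermX (k : ℕ) (x t : ℝ) :
    HasDerivAt (fun y => heatTermX d xa xb p0 y t k) (heatTermXX d xa xb p0 x t k) x := by
  refine HasDerivAt.congr_deriv (((hasDerivAt_sinMode xa xb k x).const_mul _).const_mul _) ?_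
  rw [heatTermXX]; ring

theorem hasDerivAt_heatTerm_time (k : ℕ) (x t : ℝ) :
    HasDerivAt (fun s => heatTerm d xa xb p0 x s k) (d * heatTermXX d xa xb p0 x t k) t := by
  have := ((((hasDerivAt_id t).const_mul (-d * (k * π / (xb - xa)) ^ 2)).exp).const_mul
    (cosCoeff xa xb p0 k)).mul_const (cosMode xa xb k x)
  refine HasDerivAt.congr_deriv this ?_
  simp only [heatTermXX, id]; ring

theorem continuous_heatTerm (k : ℕ) :
    Continuous fun z : ℝ × ℝ => heatTerm d xa xb p0 z.1 z.2 k := by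
  unfold heatTerm cosMode; fun_prop

theorem continuous_heatTermX (k : ℕ) :
    Continuous fun z : ℝ × ℝ => heatTermX d xa xb p0 z.1 z.2 k := by
  unfold heatTermX sinMode; fun_prop

theorem continuous_heatTermXX (k : ℕ) :
    Continuous fun z : ℝ × ℝ => heatTermXX d xa xb p0 z.1 z.2 k := by
  unfold heatTermXX cosMode; fun_prop

variable {d}

theorem abs_heatTerm_le (hd : 0 ≤ d) {t : ℝ} (ht : 0 ≤ t) (x : ℝ) (k : ℕ) :
    |heatTerm d xa xb p0 x t k| ≤ |cosCoeff xa xb p0 k| := by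
  rw [heatTerm, abs_mul, abs_mul, mul_assoc]
  have h1 : exp (-d * (k * π / (xb - xa)) ^ 2 * t) ≤ 1 := by
    rw [exp_le_one_iff]
    have : 0 ≤ d * (k * π / (xb - xa)) ^ 2 * t := by positivity
    linarith
  have h2 : |cosMode xa xb k x| ≤ 1 := abs_cos_le_one _
  rw [abs_of_pos (exp_pos _)]
  exact mul_le_of_le_one_right (abs_nonneg _)
    (mul_le_one₀ h1 (abs_nonneg _) h2)

/-- From `1 + s ≤ eˢ` with `s = d ω² t`. Diffusion absorbs two powers of the frequency, uniformly
for times at least `r`. -/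
theorem sq_mul_exp_le (hd : 0 < d) {r t : ℝ} (hr : 0 < r) (ht : r ≤ t) (ω : ℝ) :
    ω ^ 2 * exp (-d * ω ^ 2 * t) ≤ 1 / (d * r) := by
  rw [le_div_iff₀ (by positivity), show -d * ω ^ 2 * t = -(d * ω ^ 2 * t) by ring, exp_neg,
    mul_right_comm, ← div_eq_mul_inv, div_le_one (exp_pos _)]
  have h1 := add_one_le_exp (d * ω ^ 2 * t)
  have h2 : d * ω ^ 2 * r ≤ d * ω ^ 2 * t := by gcongr
  linarith

theorem abs_heatTermXX_le (hd : 0 < d) {r t : ℝ} (hr : 0 < r) (ht : r ≤ t) (x : ℝ) (k : ℕ) :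
    |heatTermXX d xa xb p0 x t k| ≤ |cosCoeff xa xb p0 k| * (1 + 1 / (d * r)) := by
  have h0 := sq_mul_exp_le hd hr ht (k * π / (xb - xa))
  have h2 : |cosMode xa xb k x| ≤ 1 := abs_cos_le_one _
  rw [heatTermXX, mul_assoc, abs_mul]
  gcongr
  rw [abs_mul, abs_mul, abs_neg, abs_of_pos (exp_pos _), abs_of_nonneg (sq_nonneg _), ← mul_assoc]
  have h3 : 0 ≤ exp (-d * (k * π / (xb - xa)) ^ 2 * t) * (k * π / (xb - xa)) ^ 2 := by positivity
  nlinarith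

theorem abs_heatTermX_le (hd : 0 < d) {r t : ℝ} (hr : 0 < r) (ht : r ≤ t) (x : ℝ) (k : ℕ) :
    |heatTermX d xa xb p0 x t k| ≤ |cosCoeff xa xb p0 k| * (1 + 1 / (d * r)) := by
  have h0 := sq_mul_exp_le hd hr ht (k * π / (xb - xa))
  have h1 : exp (-d * (k * π / (xb - xa)) ^ 2 * t) ≤ 1 := by
    rw [exp_le_one_iff]
    have : 0 ≤ d * (k * π / (xb - xa)) ^ 2 * t := by have := hr.le.trans ht; positivity
    linarith
  have h2 : |sinMode xa xb k x| ≤ 1 := abs_sin_le_one _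
  rw [heatTermX, mul_assoc, abs_mul]
  gcongr
  rw [abs_mul, abs_mul, abs_neg, abs_of_pos (exp_pos _), ← mul_assoc]
  set ω := k * π / (xb - xa)
  set E := exp (-d * ω ^ 2 * t)
  have hE : 0 < E := exp_pos _
  -- The first derivative costs only `|ω|`; this reduces it to the second-derivative bound and
  -- accounts for the summand `1` in the constant.
  have h4 : |ω| ≤ 1 + ω ^ 2 := by nlinarith [sq_abs ω, sq_nonneg (|ω| - 1), abs_nonneg ω]
  have h3 : 0 ≤ E * |ω| := by positivity
  calc E * |ω| * |sinMode xa xb k x| ≤ E * |ω| := mul_le_of_le_one_right h3 h2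
    _ ≤ E * (1 + ω ^ 2) := by gcongr
    _ ≤ 1 + 1 / (d * r) := by linarith

end HeatTerm

/-! ### The cosine series as a heat flow. -/

/-- The cosine series solution of the heat equation. -/
noncomputable def heatSeries (d xa xb : ℝ) (p0 : ℝ → ℝ) (x t : ℝ) : ℝ :=
  cosCoeff xa xb p0 0 / 2 + ∑' n : ℕ, heatTerm d xa xb p0 x t (n + 1)

section HeatSeries

variable {d xa xb : ℝ} {p0 : ℝ → ℝ}

theorem summable_heatTerm (hd : 0 ≤ d) (hs : Summable fun n : ℕ => |cosCoeff xa xb p0 (n + 1)|)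
    (x : ℝ) {t : ℝ} (ht : 0 ≤ t) : Summable fun n : ℕ => heatTerm d xa xb p0 x t (n + 1) :=
  Summable.of_norm_bounded hs fun n => abs_heatTerm_le xa xb p0 hd ht x (n + 1)

/-- In either case all exponentials equal `1`, leaving the cosine series of `p0`. One case is the
initial condition, the other the stationary flow without diffusion. -/
theorem heatSeries_eq_initial (hx : xa < xb) (hp0 : ContDiffOn ℝ 1 p0 (Icc xa xb)) {x t : ℝ}
    (hxx : x ∈ Icc xa xb) (hdt : d = 0 ∨ t = 0) : heatSeries d xa xb p0 x t = p0 x := by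
  have h := ((cosSeries hx hp0).2 x hxx).tsum_eq
  have : ∀ n : ℕ, heatTerm d xa xb p0 x t n = cosCoeff xa xb p0 n * cosMode xa xb n x := by
    intro n
    rcases hdt with rfl | rfl <;> simp [heatTerm]
  simp only [heatSeries, this, h]
  ring

/-- Summability of the coefficients themselves gives a bound uniform down to `t = 0`, so no
smoothing is needed. -/
theorem continuousOn_heatSeries (hd : 0 ≤ d)
    (hs : Summable fun n : ℕ => |cosCoeff xa xb p0 (n + 1)|) :
    ContinuousOn (fun z : ℝ × ℝ => heatSeries d xa xb p0 z.1 z.2) (univ ×ˢ Ici 0) :=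
  continuousOn_const.add (continuousOn_tsum
    (fun n => (continuous_heatTerm d xa xb p0 (n + 1)).continuousOn) hs
    fun n z hz => abs_heatTerm_le xa xb p0 hd hz.2 z.1 (n + 1))

/-- The bounds on the derivative series blow up as `t → 0`, so the Weierstrass test is applied on
the neighbourhood of times larger than half the given one. -/
theorem continuousOn_tsum_of_bound_time {f : ℕ → ℝ × ℝ → ℝ} (hf : ∀ n, Continuous (f n))
    (hb : ∀ r > 0, ∃ u : ℕ → ℝ, Summable u ∧ ∀ n, ∀ z : ℝ × ℝ, r ≤ z.2 → |f n z| ≤ u n) :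
    ContinuousOn (fun z => ∑' n, f n z) (univ ×ˢ Ioi 0) := by
  intro z hz
  have hz2 : 0 < z.2 := hz.2
  obtain ⟨u, hu, hfu⟩ := hb (z.2 / 2) (half_pos hz2)
  have := continuousOn_tsum (s := univ ×ˢ Ioi (z.2 / 2)) (fun n => (hf n).continuousOn) hu
    fun n y hy => hfu n y (le_of_lt hy.2)
  exact (this.continuousAt ((isOpen_univ.prod isOpen_Ioi).mem_nhds
    ⟨mem_univ _, half_lt_self hz2⟩)).continuousWithinAt

theorem continuousOn_tsum_heatTermX (hd : 0 < d)
    (hs : Summable fun n : ℕ => |cosCoeff xa xb p0 (n + 1)|) :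
    ContinuousOn (fun z : ℝ × ℝ => ∑' n : ℕ, heatTermX d xa xb p0 z.1 z.2 (n + 1))
      (univ ×ˢ Ioi 0) :=
  continuousOn_tsum_of_bound_time (fun n => continuous_heatTermX d xa xb p0 (n + 1))
    fun r hr => ⟨_, hs.mul_right (1 + 1 / (d * r)),
      fun n z hz => abs_heatTermX_le xa xb p0 hd hr hz z.1 (n + 1)⟩

theorem continuousOn_tsum_heatTermXX (hd : 0 < d)
    (hs : Summable fun n : ℕ => |cosCoeff xa xb p0 (n + 1)|) :
    ContinuousOn (fun z : ℝ × ℝ => ∑' n : ℕ, heatTermXX d xa xb p0 z.1 z.2 (n + 1))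
      (univ ×ˢ Ioi 0) :=
  continuousOn_tsum_of_bound_time (fun n => continuous_heatTermXX d xa xb p0 (n + 1))
    fun r hr => ⟨_, hs.mul_right (1 + 1 / (d * r)),
      fun n z hz => abs_heatTermXX_le xa xb p0 hd hr hz z.1 (n + 1)⟩

theorem hasDerivAt_heatSeries (hd : 0 < d)
    (hs : Summable fun n : ℕ => |cosCoeff xa xb p0 (n + 1)|)
    (x : ℝ) {t : ℝ} (ht : 0 < t) :
    HasDerivAt (fun y => heatSeries d xa xb p0 y t)
      (∑' n : ℕ, heatTermX d xa xb p0 x t (n + 1)) x :=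
  (hasDerivAt_tsum (hs.mul_right (1 + 1 / (d * t)))
    (fun n y => hasDerivAt_heatTerm d xa xb p0 (n + 1) y t)
    (fun n y => abs_heatTermX_le xa xb p0 hd ht le_rfl y (n + 1))
    (summable_heatTerm hd.le hs x ht.le) x).const_add _

theorem hasDerivAt_tsum_heatTermX (hd : 0 < d)
    (hs : Summable fun n : ℕ => |cosCoeff xa xb p0 (n + 1)|)
    (x : ℝ) {t : ℝ} (ht : 0 < t) :
    HasDerivAt (fun y => ∑' n : ℕ, heatTermX d xa xb p0 y t (n + 1))
      (∑' n : ℕ, heatTermXX d xa xb p0 x t (n + 1)) x :=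
  hasDerivAt_tsum (hs.mul_right (1 + 1 / (d * t)))
    (fun n y => hasDerivAt_heatTermX d xa xb p0 (n + 1) y t)
    (fun n y => abs_heatTermXX_le xa xb p0 hd ht le_rfl y (n + 1))
    (Summable.of_norm_bounded (hs.mul_right (1 + 1 / (d * t)))
      fun n => abs_heatTermX_le xa xb p0 hd ht le_rfl x (n + 1)) x

theorem hasDerivAt_heatSeries_time (hd : 0 < d)
    (hs : Summable fun n : ℕ => |cosCoeff xa xb p0 (n + 1)|)
    (x : ℝ) {t : ℝ} (ht : 0 < t) :
    HasDerivAt (fun s => heatSeries d xa xb p0 x s)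
      (d * ∑' n : ℕ, heatTermXX d xa xb p0 x t (n + 1)) t := by
  rw [← tsum_mul_left]
  refine (hasDerivAt_tsum_of_isPreconnected (t := Ioi (t / 2))
    ((hs.mul_right (1 + 1 / (d * (t / 2)))).mul_left d) isOpen_Ioi isPreconnected_Ioi
    (fun n y _ => hasDerivAt_heatTerm_time d xa xb p0 (n + 1) x y)
    (fun n y hy => ?_) (half_lt_self ht)
    (summable_heatTerm hd.le hs x ht.le) (half_lt_self ht)).const_add _
  rw [norm_mul, norm_eq_abs, abs_of_pos hd]
  exact mul_le_mul_of_nonneg_left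
    (abs_heatTermXX_le xa xb p0 hd (half_pos ht) (le_of_lt hy) x (n + 1)) hd.le

end HeatSeries

theorem tsum_heatTermX_boundary (d t : ℝ) {xa xb : ℝ} (p0 : ℝ → ℝ) (hx : xa < xb) {x : ℝ}
    (hxx : x ∈ ({xa, xb} : Set ℝ)) : ∑' n : ℕ, heatTermX d xa xb p0 x t (n + 1) = 0 := by
  have : ∀ k, sinMode xa xb k x = 0 := by
    intro k
    rcases hxx with rfl | rfl
    · simp [sinMode]
    · rw [sinMode, div_self (sub_pos.mpr hx).ne', mul_one, sin_nat_mul_pi]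
  simp [heatTermX, this]

theorem isHeatSolution_heatSeries {d xa xb T : ℝ} {p0 : ℝ → ℝ} (hd : 0 < d) (hx : xa < xb)
    (hs : Summable fun n : ℕ => |cosCoeff xa xb p0 (n + 1)|) :
    IsHeatSolution T d xa xb (heatSeries d xa xb p0)
      (fun x t => ∑' n : ℕ, heatTermX d xa xb p0 x t (n + 1))
      (fun x t => ∑' n : ℕ, heatTermXX d xa xb p0 x t (n + 1)) where
  cont := (continuousOn_heatSeries hd.le hs).mono fun _ hz => ⟨mem_univ _, hz.2.1⟩
  deriv_x x _ _ ht := hasDerivAt_heatSeries hd hs x ht.1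
  deriv_xx x _ _ ht := hasDerivAt_tsum_heatTermX hd hs x ht.1
  deriv_t x _ _ ht := hasDerivAt_heatSeries_time hd hs x ht.1
  neumann x hxx t ht := by
    have := (hasDerivAt_heatSeries hd hs x ht.1).hasDerivWithinAt (s := Icc xa xb)
    rwa [tsum_heatTermX_boundary d t p0 hx hxx] at this

/-! ### From heat flows to pollution paths and back. -/

theorem growthFactor_pos (η δ ρ θ T t : ℝ) : 0 < growthFactor η δ ρ θ T t := exp_pos _

theorem growthFactor_zero (η δ ρ θ T : ℝ) : growthFactor η δ ρ θ T 0 = 1 := by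
  simp [growthFactor]

theorem continuousOn_growthFactor (δ ρ : ℝ) {η θ T : ℝ} (hη : 0 < η) (hθ : 0 < θ) (hθ1 : θ ≤ 1) :
    ContinuousOn (growthFactor η δ ρ θ T) (Icc 0 T) := fun t ht => by
  simpa using ((isStockPath_localTax (T := T) δ ρ 1 hη hθ hθ1).ode t ht).continuousWithinAt

theorem hasDerivAt_growthFactor (δ ρ : ℝ) {η θ T t : ℝ} (hη : 0 < η) (hθ : 0 < θ) (hθ1 : θ ≤ 1)
    (ht : t ∈ Ioo 0 T) :
    HasDerivAt (growthFactor η δ ρ θ T)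
      ((η - δ - η * localTax η δ ρ θ T t) * growthFactor η δ ρ θ T t) t := by
  have := ((isStockPath_localTax (T := T) δ ρ 1 hη hθ hθ1).ode t
    (Ioo_subset_Icc_self ht)).hasDerivAt (Icc_mem_nhds ht.1 ht.2)
  simp only [one_mul] at this
  exact this.congr_deriv (by ring)

theorem localPollution_eq (η δ ρ θ T d xa xb : ℝ) (p0 : ℝ → ℝ) (x t : ℝ) :
    localPollution η δ ρ θ T d xa xb p0 x t =
      growthFactor η δ ρ θ T t * heatSeries d xa xb p0 x t := rfl

/-- A heat flow times the growth factor is a pollution path under the local tax. -/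
theorem isPollutionSolution_growthFactor_mul (δ ρ : ℝ) {η θ T d xa xb : ℝ} {p0 : ℝ → ℝ}
    (hη : 0 < η) (hθ : 0 < θ) (hθ1 : θ ≤ 1) {v vx vxx : ℝ → ℝ → ℝ}
    (cont : ContinuousOn (fun z : ℝ × ℝ => v z.1 z.2) (Icc xa xb ×ˢ Icc 0 T))
    (init : ∀ x ∈ Icc xa xb, v x 0 = p0 x)
    (deriv_x : ∀ x ∈ Icc xa xb, ∀ t ∈ Ioc 0 T,
      HasDerivWithinAt (fun y => v y t) (vx x t) (Icc xa xb) x)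
    (cont_x : ContinuousOn (fun z : ℝ × ℝ => vx z.1 z.2) (Icc xa xb ×ˢ Ioc 0 T))
    (deriv_xx : ∀ x ∈ Ioo xa xb, ∀ t ∈ Ioo 0 T, HasDerivAt (fun y => vx y t) (vxx x t) x)
    (cont_xx : ContinuousOn (fun z : ℝ × ℝ => vxx z.1 z.2) (Ioo xa xb ×ˢ Ioo 0 T))
    (deriv_t : ∀ x ∈ Ioo xa xb, ∀ t ∈ Ioo 0 T, HasDerivAt (fun s => v x s) (d * vxx x t) t)
    (neumann : ∀ x ∈ ({xa, xb} : Set ℝ), ∀ t ∈ Ioc 0 T,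
      HasDerivWithinAt (fun y => v y t) 0 (Icc xa xb) x) :
    IsPollutionSolution η δ T d xa xb p0 (fun x t => growthFactor η δ ρ θ T t * v x t)
      (fun x t => localTax η δ ρ θ T t * (growthFactor η δ ρ θ T t * v x t)) := by
  have hG := continuousOn_growthFactor (T := T) δ ρ hη hθ hθ1
  have hn : ∀ x ∈ ({xa, xb} : Set ℝ), ∀ t ∈ Ioc 0 T,
      HasDerivWithinAt (fun y => growthFactor η δ ρ θ T t * v y t) 0 (Icc xa xb) x := by
    intro x hx t ht
    simpa using (neumann x hx t ht).const_mul (growthFactor η δ ρ θ T t)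
  have hG2 : ∀ {s u : Set ℝ}, u ⊆ Icc 0 T →
      ContinuousOn (fun z : ℝ × ℝ => growthFactor η δ ρ θ T z.2) (s ×ˢ u) := fun hu =>
    hG.comp continuousOn_snd fun z hz => hu hz.2
  refine ⟨(hG2 le_rfl).mul cont, fun x hx => by simp [growthFactor_zero, init x hx],
    ⟨fun x t => growthFactor η δ ρ θ T t * vx x t, fun x t => growthFactor η δ ρ θ T t * vxx x t,
      fun x hx t ht => (deriv_x x hx t ht).const_mul _,
      (hG2 Ioc_subset_Icc_self).mul cont_x,
      fun x hx t ht => (deriv_xx x hx t ht).const_mul _,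
      (hG2 Ioo_subset_Icc_self).mul cont_xx,
      fun x hx t ht => ?_⟩, hn, fun x hx t ht => ?_⟩
  · refine ((hasDerivAt_growthFactor δ ρ hη hθ hθ1 ht).mul (deriv_t x hx t ht)).congr_deriv ?_
    ring
  · simpa using (hn x hx t ht).const_mul (localTax η δ ρ θ T t)

theorem isPollutionSolution_localPollution (δ ρ : ℝ) {η θ T d xa xb : ℝ} {p0 : ℝ → ℝ}
    (hη : 0 < η) (hθ : 0 < θ) (hθ1 : θ ≤ 1) (hd : 0 < d) (hx : xa < xb)
    (hp0 : ContDiffOn ℝ 1 p0 (Icc xa xb)) :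
    IsPollutionSolution η δ T d xa xb p0 (localPollution η δ ρ θ T d xa xb p0)
      (fun x t => localTax η δ ρ θ T t * localPollution η δ ρ θ T d xa xb p0 x t) := by
  have hs := (cosSeries hx hp0).1
  exact isPollutionSolution_growthFactor_mul δ ρ hη hθ hθ1
    (isHeatSolution_heatSeries hd hx hs).cont
    (fun x hxx => heatSeries_eq_initial hx hp0 hxx (Or.inr rfl))
    (fun x _ t ht => (hasDerivAt_heatSeries hd hs x ht.1).hasDerivWithinAt)
    ((continuousOn_tsum_heatTermX hd hs).mono fun _ hz => ⟨mem_univ _, hz.2.1⟩)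
    (isHeatSolution_heatSeries hd hx hs).deriv_xx
    ((continuousOn_tsum_heatTermXX hd hs).mono fun _ hz => ⟨mem_univ _, hz.2.1⟩)
    (isHeatSolution_heatSeries hd hx hs).deriv_t
    (fun x hxx t ht => by
      have := (hasDerivAt_heatSeries hd hs x ht.1).hasDerivWithinAt (s := Icc xa xb)
      rwa [tsum_heatTermX_boundary d t p0 hx hxx] at this)

/-- Without diffusion nothing is smoothed: the flow stays equal to `p0`, whose own derivatives must
supply the regularity and the Neumann conditions. -/
theorem isPollutionSolution_localPollution_zero (δ ρ : ℝ) {η θ T xa xb : ℝ} {p0 : ℝ → ℝ}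
    (hη : 0 < η) (hθ : 0 < θ) (hθ1 : θ ≤ 1) (hx : xa < xb)
    (hp0 : ContDiffOn ℝ 2 p0 (Icc xa xb)) (ha : derivWithin p0 (Icc xa xb) xa = 0)
    (hb : derivWithin p0 (Icc xa xb) xb = 0) :
    IsPollutionSolution η δ T 0 xa xb p0 (localPollution η δ ρ θ T 0 xa xb p0)
      (fun x t => localTax η δ ρ θ T t * localPollution η δ ρ θ T 0 xa xb p0 x t) := by
  have hp1 : ContDiffOn ℝ 1 p0 (Icc xa xb) := hp0.of_le one_le_two
  have hu := uniqueDiffOn_Icc hx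
  have hv : ∀ x ∈ Icc xa xb, ∀ t, heatSeries 0 xa xb p0 x t = p0 x :=
    fun x hxx t => heatSeries_eq_initial hx hp1 hxx (Or.inl rfl)
  have hD : ContDiffOn ℝ 1 (derivWithin p0 (Icc xa xb)) (Icc xa xb) :=
    hp0.derivWithin hu (by norm_num)
  have hDD : ContinuousOn (derivWithin (derivWithin p0 (Icc xa xb)) (Icc xa xb)) (Icc xa xb) :=
    hD.continuousOn_derivWithin hu le_rfl
  have hdx : ∀ x ∈ Icc xa xb, ∀ t, HasDerivWithinAt (fun y => heatSeries 0 xa xb p0 y t)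
      (derivWithin p0 (Icc xa xb) x) (Icc xa xb) x := fun x hxx t =>
    (hp1.differentiableOn one_ne_zero x hxx).hasDerivWithinAt.congr (fun y hy => hv y hy t)
      (hv x hxx t)
  refine isPollutionSolution_growthFactor_mul δ ρ hη hθ hθ1
    (v := heatSeries 0 xa xb p0)
    (vx := fun x _ => derivWithin p0 (Icc xa xb) x)
    (vxx := fun x _ => derivWithin (derivWithin p0 (Icc xa xb)) (Icc xa xb) x)
    ?_ (fun x hxx => hv x hxx 0) (fun x hxx t _ => hdx x hxx t)
    (hD.continuousOn.comp continuousOn_fst fun z hz => hz.1)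
    (fun x hxx t _ => (hD.differentiableOn one_ne_zero x
      (Ioo_subset_Icc_self hxx)).hasDerivWithinAt.hasDerivAt (Icc_mem_nhds hxx.1 hxx.2))
    (hDD.comp continuousOn_fst fun z hz => Ioo_subset_Icc_self hz.1) (fun x hxx t _ => ?_)
    (fun x hxx t _ => ?_)
  · exact (hp1.continuousOn.comp continuousOn_fst fun z hz => hz.1).congr
      fun z hz => hv z.1 hz.1 z.2
  · have : (fun s => heatSeries 0 xa xb p0 x s) = fun _ => p0 x :=
      funext (hv x (Ioo_subset_Icc_self hxx))
    rw [this, zero_mul]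
    exact hasDerivAt_const t _
  · rcases hxx with rfl | rfl
    · have := hdx x (left_mem_Icc.mpr hx.le) t
      rwa [ha] at this
    · have := hdx x (right_mem_Icc.mpr hx.le) t
      rwa [hb] at this

/-- Under the local tax, the pollution divided by the growth factor is a heat flow. -/
theorem IsPollutionSolution.isHeatSolution_div (ρ : ℝ) {η δ θ T d xa xb : ℝ} {p0 : ℝ → ℝ}
    {p u : ℝ → ℝ → ℝ} (hη : 0 < η) (hθ : 0 < θ) (hθ1 : θ ≤ 1)
    (h : IsPollutionSolution η δ T d xa xb p0 p u)
    (hu : ∀ x ∈ Icc xa xb, ∀ t ∈ Icc 0 T, u x t = localTax η δ ρ θ T t * p x t) :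
    ∃ vx vxx, IsHeatSolution T d xa xb (fun x t => p x t / growthFactor η δ ρ θ T t) vx vxx := by
  obtain ⟨px, pxx, hpx, -, hpxx, -, hpt⟩ := h.pde
  refine ⟨fun x t => px x t / growthFactor η δ ρ θ T t,
    fun x t => pxx x t / growthFactor η δ ρ θ T t, ?_, fun x hx t ht => ?_, fun x hx t ht => ?_,
    fun x hx t ht => ?_, fun x hx t ht => ?_⟩
  · exact h.cont.div ((continuousOn_growthFactor δ ρ hη hθ hθ1).comp continuousOn_snd
      fun z hz => hz.2) fun z _ => (growthFactor_pos η δ ρ θ T z.2).ne'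
  · exact ((hpx x (Ioo_subset_Icc_self hx) t (Ioo_subset_Ioc_self ht)).hasDerivAt
      (Icc_mem_nhds hx.1 hx.2)).div_const _
  · exact (hpxx x hx t ht).div_const _
  · have hG := (growthFactor_pos η δ ρ θ T t).ne'
    refine ((hpt x hx t ht).div (hasDerivAt_growthFactor δ ρ hη hθ hθ1 ht) hG).congr_deriv ?_
    -- The control is now proportional to `p`, so the derivative of the growth factor cancels all
    -- reaction terms.
    rw [hu x (Ioo_subset_Icc_self hx) t (Ioo_subset_Icc_self ht)]
    field_simp
    ring
  · simpa using (h.neumann_p x hx t (Ioo_subset_Ioc_self ht)).div_const (growthFactor η δ ρ θ T t)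

/-- Without diffusion a heat flow is stationary. -/
theorem IsHeatSolution.eq_initial_of_zero {T xa xb : ℝ} {v vx vxx : ℝ → ℝ → ℝ}
    (hv : IsHeatSolution T 0 xa xb v vx vxx) (hxx : xa < xb) (hT : 0 < T)
    {x t : ℝ} (hx : x ∈ Icc xa xb) (ht : t ∈ Icc 0 T) : v x t = v x 0 := by
  have hc : ∀ s ∈ Icc 0 T, ContinuousOn (fun y => v y s) (Icc xa xb) := fun s hs =>
    hv.cont.comp (f := fun y : ℝ => (y, s)) (by fun_prop) fun y hy => ⟨hy, hs⟩
  -- The equation is available only at interior points; the mean value theorem settles those, and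
  -- continuity in space the two ends.
  have key : EqOn (fun y => v y t) (fun y => v y 0) (Ioo xa xb) := by
    intro y hy
    rcases eq_or_lt_of_le ht.1 with rfl | h0
    · rfl
    obtain ⟨c, hcm, hcd⟩ := exists_hasDerivAt_eq_slope (fun s => v y s) (fun _ => 0) h0
      (hv.cont.comp (f := fun s : ℝ => (y, s)) (by fun_prop)
        fun s hs => ⟨Ioo_subset_Icc_self hy, hs.1, hs.2.trans ht.2⟩)
      fun s hs => by simpa using hv.deriv_t y hy s ⟨hs.1, hs.2.trans_le ht.2⟩
    rw [eq_comm, div_eq_zero_iff, sub_eq_zero, sub_eq_zero] at hcd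
    exact hcd.resolve_right h0.ne'
  exact key.of_subset_closure (hc t ht) (hc 0 (left_mem_Icc.mpr hT.le)) Ioo_subset_Icc_self
    (by rw [closure_Ioo hxx.ne]) hx

/-! ### Symmetric data and the final assembly. -/

/-- Symmetric data have no odd cosine coefficients. -/
theorem cosCoeff_odd_eq_zero {xa xb : ℝ} (hx : xa < xb) {p0 : ℝ → ℝ}
    (hsym : ∀ x ∈ Icc xa xb, p0 (xa + xb - x) = p0 x) {k : ℕ} (hk : Odd k) :
    cosCoeff xa xb p0 k = 0 := by
  have h1 := intervalIntegral.integral_comp_sub_left (fun x => p0 x * cosMode xa xb k x) (xa + xb)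
    (a := xa) (b := xb)
  rw [add_sub_cancel_right, add_sub_cancel_left] at h1
  have h2 : ∫ x in xa..xb, p0 (xa + xb - x) * cosMode xa xb k (xa + xb - x) =
      ∫ x in xa..xb, -(p0 x * cosMode xa xb k x) := by
    refine intervalIntegral.integral_congr fun x hxx => ?_
    rw [uIcc_of_le hx.le] at hxx
    have h3 : (k : ℝ) * π * ((xa + xb - x - xa) / (xb - xa)) =
        k * π - k * π * ((x - xa) / (xb - xa)) := by
      have := (sub_pos.mpr hx).ne'
      field_simp
      ring
    simp only [hsym x hxx, cosMode]
    -- The reflection multiplies the mode by `(-1)^k = -1`, so the integral equals its own negative.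
    rw [h3, cos_nat_mul_pi_sub, hk.neg_one_pow]
    ring
  rw [h2, intervalIntegral.integral_neg] at h1
  rw [cosCoeff, mul_eq_zero]
  right
  linarith

theorem proposition6 (η δ ρ θ T d xa xb : ℝ) (hη : 0 < η) (hδ : 0 < δ) (hρ : 0 < ρ)
    (hθ : 0 < θ) (hθ1 : θ ≤ 1) (hT : 0 < T) (hd : 0 ≤ d) (hx : xa < xb)
    (p0 : ℝ → ℝ) (hp0 : ContDiffOn ℝ 1 p0 (Icc xa xb)) (hpos : ∀ x ∈ Icc xa xb, 0 < p0 x) :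
    -- the cosine series converges
    (∀ x ∈ Icc xa xb, ∀ t ∈ Icc 0 T,
      Summable (fun n : ℕ => heatTerm d xa xb p0 x t (n + 1))) ∧
    -- the closed form is a locally optimal pair
    ((d = 0 → ContDiffOn ℝ 2 p0 (Icc xa xb) ∧
        derivWithin p0 (Icc xa xb) xa = 0 ∧ derivWithin p0 (Icc xa xb) xb = 0) →
      IsLocallyOptimal η δ ρ θ T d xa xb p0
        (fun _ t => localTax η δ ρ θ T t)
        (fun x t => localPollution η δ ρ θ T d xa xb p0 x t)
        (fun x t => localTax η δ ρ θ T t * localPollution η δ ρ θ T d xa xb p0 x t)) ∧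
    -- every locally optimal pair is given by the closed form
    (∀ τ p u : ℝ → ℝ → ℝ, IsLocallyOptimal η δ ρ θ T d xa xb p0 τ p u →
      ∀ x ∈ Icc xa xb, ∀ t ∈ Icc 0 T,
        τ x t = localTax η δ ρ θ T t ∧
        p x t = localPollution η δ ρ θ T d xa xb p0 x t ∧
        u x t = localTax η δ ρ θ T t * p x t) ∧
    -- for symmetric initial data only the frequencies `2 n π / (xb - xa)` occur
    ((∀ x ∈ Icc xa xb, p0 (xa + xb - x) = p0 x) →
      ∀ x ∈ Icc xa xb, ∀ t ∈ Icc 0 T,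
        Summable (fun n : ℕ => heatTerm d xa xb p0 x t (2 * (n + 1))) ∧
        localPollution η δ ρ θ T d xa xb p0 x t =
          growthFactor η δ ρ θ T t *
            (cosCoeff xa xb p0 0 / 2 +
              ∑' n : ℕ, heatTerm d xa xb p0 x t (2 * (n + 1)))) := by
  have hs := (cosSeries hx hp0).1
  refine ⟨fun x _ t ht => summable_heatTerm hd hs x ht.1, fun h0 => ?_, fun τ p u h x hxx t ht => ?_,
    fun hsym x _ t ht => ?_⟩
  · refine ⟨fun x _ => isOptimalTax_localTax δ ρ (p0 x) hη hθ hθ1 hT, fun _ _ _ _ => rfl, ?_⟩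
    rcases eq_or_lt_of_le hd with rfl | hd'
    · obtain ⟨h2, ha, hb⟩ := h0 rfl
      exact isPollutionSolution_localPollution_zero δ ρ hη hθ hθ1 hx h2 ha hb
    · exact isPollutionSolution_localPollution δ ρ hη hθ hθ1 hd' hx hp0
  · have hτ : ∀ x ∈ Icc xa xb, ∀ t ∈ Icc 0 T, τ x t = localTax η δ ρ θ T t := fun x hxx t ht =>
      (h.tax x hxx).eq_localTax hη hθ hθ1 hT (hpos x hxx).ne' ht
    have hu : ∀ x ∈ Icc xa xb, ∀ t ∈ Icc 0 T, u x t = localTax η δ ρ θ T t * p x t :=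
      fun x hxx t ht => by rw [h.control x hxx t ht, hτ x hxx t ht]
    refine ⟨hτ x hxx t ht, ?_, hu x hxx t ht⟩
    obtain ⟨vx, vxx, hv⟩ := h.pollution.isHeatSolution_div ρ hη hθ hθ1 hu
    have hinit : ∀ y ∈ Icc xa xb, p y 0 / growthFactor η δ ρ θ T 0 = p0 y := fun y hy => by
      rw [growthFactor_zero, div_one, h.pollution.init y hy]
    have hG := (growthFactor_pos η δ ρ θ T t).ne'
    rw [localPollution_eq, mul_comm, ← div_eq_iff hG]
    rcases eq_or_lt_of_le hd with rfl | hd'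
    · rw [heatSeries_eq_initial hx hp0 hxx (Or.inl rfl), ← hinit x hxx]
      exact hv.eq_initial_of_zero hx hT hxx ht
    · exact hv.eq_of_initial (isHeatSolution_heatSeries hd' hx hs) hx hd hT
        (fun y hy => by
          rw [heatSeries_eq_initial hx hp0 hy (Or.inr rfl)]; exact hinit y hy) hxx ht
  · have hsum := summable_heatTerm hd hs x ht.1
    -- The series is indexed from frequency `n + 1`, so the even frequency `2 (n + 1)` sits at index
    -- `2 n + 1`.
    have hinj : Function.Injective fun n : ℕ => 2 * n + 1 := fun a b hab => by
      simpa using hab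
    have hzero : ∀ n ∉ range fun n : ℕ => 2 * n + 1, heatTerm d xa xb p0 x t (n + 1) = 0 := by
      intro n hn
      have : Odd (n + 1) := by
        by_contra hno
        obtain ⟨m, hm⟩ := Nat.not_odd_iff_even.mp hno
        -- Here `n + 1 = m + m` forces `m ≥ 1`, so the truncated subtraction is exact.
        exact hn ⟨m - 1, by dsimp only; omega⟩
      simp [heatTerm, cosCoeff_odd_eq_zero hx hsym this]
    refine ⟨hsum.comp_injective hinj, ?_⟩
    rw [localPollution, ← hinj.tsum_eq (f := fun n => heatTerm d xa xb p0 x t (n + 1))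
      (Function.support_subset_iff'.mpr hzero)]
    rfl
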